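/- Let $F$ be a $\sigma$-finite measure on $\mathbb{R}$ that is not concentrated on a single point (i.e. $F(\mathbb{R}\setminus\{c\})\neq 0$ for every $c\in\mathbb{R}$), let $\Omega$ be the interior of its natural parameter space $\{\xi\in\mathbb{R} : \int e^{\xi x}\,dF(x)<\infty\}$, and for $\xi\in\Omega$ let $f_\xi(x)=\exp(\xi x-b(\xi))$, $b(\xi)=\log\int e^{\xi x}\,dF(x)$, be the density with respect to $F$ of the corresponding one-parameter exponential family. Let $X_1,X_2,\dots$ be the sequence of observations. Write $\mathbf{P}_\theta,\mathbf{E}_\theta$ for probability and expectation when $X_1,X_2,\dots$ are independent with density $f_\theta$, and $\mathbf{P}^{(\nu)}_{\theta,\lambda},\mathbf{E}^{(\nu)}_{\theta,\lambda}$ ($\nu\ge 1$) for those when the $X_n$ are independent, $X_1,\dots,X_{\nu-1}$ with density $f_\theta$ and $X_\nu,X_{\nu+1},\dots$ with density $f_\lambda$. Let $I(\lambda,\theta)=\mathbf{E}_\lambda\log\big(f_\lambda(X_1)/f_\theta(X_1)\big)$ and, for a stopping time $N\in\{0,1,2,\dots\}\cup\{\infty\}$ of the filtration $\sigma(X_1,\dots,X_n)$,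 $n\ge 0$, let $$\overline{\mathbf{E}}_\lambda N=\sup_{\nu\ge 1}\ \operatorname{ess\,sup}\ \mathbf{E}^{(\nu)}_{\theta,\lambda}\big[(N-\nu+1)^+\,\big|\,X_1,\dots,X_{\nu-1}\big]\in[0,\infty],$$ where the essential supremum is taken under $\mathbf{P}^{(\nu)}_{\theta,\lambda}$. **Proposition 2.1.** Given $\theta,\lambda\in\Omega$ with $\lambda\neq\theta$, there exists a constant $M=M(\theta,\lambda)>0$ (depending also on the family, i.e. on $F$) such that for every stopping time $N$, $$\log \mathbf{E}_\theta N\le I(\lambda,\theta)\,\overline{\mathbf{E}}_\lambda N+M,$$ as an inequality between extended real numbers (with $\log 0=-\infty$ and $\log\infty=\infty$). -/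

import Mathlib

open MeasureTheory ProbabilityTheory
open scoped ENNReal

noncomputable section

namespace ChangePoint

/-- The density `f_ξ(x) = exp(ξ x - b(ξ))` with respect to `F`. Here `cgf id F ξ` is the
log-normaliser `b(ξ) = log ∫ exp(ξ x) dF(x)`. -/
def density (F : Measure ℝ) (ξ x : ℝ) : ℝ :=
  Real.exp (ξ * x - cgf id F ξ)

/-- The distribution on `ℝ` with density `f_ξ` with respect to `F`. -/
def law (F : Measure ℝ) (ξ : ℝ) : Measure ℝ :=
  F.withDensity fun x => ENNReal.ofReal (density F ξ x)

/-- On the natural parameter space of a nonzero `F`, the density `f_ξ` has total mass one. -/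
theorem isProbabilityMeasure_law (F : Measure ℝ) (hF : F ≠ 0) (ξ : ℝ)
    (hξ : ξ ∈ integrableExpSet id F) : IsProbabilityMeasure (law F ξ) := by
  have hint : Integrable (fun x : ℝ => Real.exp (ξ * x)) F := hξ
  have hpos : 0 < mgf id F ξ := mgf_pos' hF hξ
  have h1 : (fun x => density F ξ x) = fun x => Real.exp (ξ * x) / mgf id F ξ := by
    funext x
    rw [density, Real.exp_sub, cgf, Real.exp_log hpos]
  refine ⟨?_⟩
  rw [law, withDensity_apply _ MeasurableSet.univ, setLIntegral_univ,
    ← ofReal_integral_eq_lintegral_ofReal]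
  · rw [h1, integral_div]
    have : ∫ x, Real.exp (ξ * x) ∂F = mgf id F ξ := rfl
    rw [this, div_self hpos.ne', ENNReal.ofReal_one]
  · exact (hint.div_const _).congr (Filter.Eventually.of_forall fun x => (congrFun h1 x).symm)
  · exact Filter.Eventually.of_forall fun x => (Real.exp_pos _).le

/-- The Kullback–Leibler information number `I(λ, θ) = E_λ log (f_λ(X) / f_θ(X))`. -/
def klInfo (F : Measure ℝ) (lam θ : ℝ) : ℝ :=
  ∫ x, Real.log (density F lam x / density F θ x) ∂(law F lam)

/-! A point `ω : ℕ → ℝ` is a sequence of observations; the `n`-th observation `X_n`, `n ≥ 1`,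
is `ω (n - 1)`, so that `X_1, …, X_n` are the coordinates of `ω` in `Finset.range n`. -/

/-- The filtration generated by the observations: its `n`-th member is `σ(X_1, …, X_n)`, which is
trivial for `n = 0`. -/
def obsFiltration : Filtration ℕ (MeasurableSpace.pi : MeasurableSpace (ℕ → ℝ)) where
  seq n := Filtration.piFinset (X := fun _ : ℕ => ℝ) (Finset.range n)
  mono' _ _ h := Filtration.piFinset.mono (Finset.range_mono h)
  le' n := Filtration.piFinset.le (Finset.range n)

/-- `P_θ`: the observations are independent with density `f_θ`. -/
def iidLaw (F : Measure ℝ) (θ : ℝ) : Measure (ℕ → ℝ) :=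
  Measure.infinitePi fun _ => law F θ

/-- `P_{θ,λ}^{(ν)}`, `ν ≥ 1`: the observations are independent, `X_1, …, X_{ν-1}` with density
`f_θ` and `X_ν, X_{ν+1}, …` with density `f_λ`. -/
def changeLaw (F : Measure ℝ) (θ lam : ℝ) (ν : ℕ) : Measure (ℕ → ℝ) :=
  Measure.infinitePi fun i => if i + 1 < ν then law F θ else law F lam

/-- The long average run length `E_θ N ∈ [0, ∞]`. -/
def longARL (F : Measure ℝ) (θ : ℝ) (N : (ℕ → ℝ) → ℕ∞) : ℝ≥0∞ :=
  ∫⁻ ω, (N ω : ℝ≥0∞) ∂(iidLaw F θ)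

/-- The short average run length (worst-case detection delay)
`sup_{ν ≥ 1} ess sup E_{θ,λ}^{(ν)} [(N - ν + 1)⁺ | X_1, …, X_{ν-1}] ∈ [0, ∞]`.
Subtraction in `ℕ∞` is truncated at zero and satisfies `⊤ + 1 - ν = ⊤`, so `N ω + 1 - ν` is the
positive part; the conditional expectation is that of a `[0, ∞]`-valued random variable. -/
def shortARL (F : Measure ℝ) (θ lam : ℝ) (N : (ℕ → ℝ) → ℕ∞) : ℝ≥0∞ :=
  ⨆ (ν : ℕ) (_ : 1 ≤ ν),
    essSup
      (condLExp (obsFiltration (ν - 1)) (changeLaw F θ lam ν)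
        fun ω => ((N ω + 1 - (ν : ℕ∞) : ℕ∞) : ℝ≥0∞))
      (changeLaw F θ lam ν)

end ChangePoint

end

noncomputable section

namespace ChangePoint

/-! Put `L = f_λ/f_θ`, let `R_n` be `srStat L n`, `D` the worst-case delay, and `a` the `P_θ`-mean
of `min(N, m)`. The proof bounds the `P_θ`-mean of the sum of `1 + R_n` over `n < min(N, m)` from
both sides.

Upper bound (`sum_lintegral_srStat_le`): `1 + R_n` is the sum, over all change points, of the
likelihood ratios of the first `n` observations. A change of measure turns the mean into a sum over
`k` of truncated delays on `{N > k}`, which is at most `D * a`.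

Lower bound (`mul_log_le_of_survival`): `R_n - n` is a `P_θ`-martingale, so the stopped `R` has mean
`a`, and by convexity the stopped `R log R` has mean at least `a log a`. The drift of `R log R` is
at most `I (1 + R_n) + 2 √(1 + R_n) + 1`. Since `ρ = E_θ √L < 1`, the process `√(1 + R_n)` is a
Lyapunov function, and the square roots sum to `O(a)`.

Dividing by `a` gives `log a ≤ I * D + 1 + 4/(1 - ρ)`, uniformly in `m`; then `m → ∞`. -/

/-- The Shiryaev–Roberts statistic of the likelihood ratio `L`. -/
def srStat (L : ℝ → ℝ) : ℕ → (ℕ → ℝ) → ℝ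
  | 0, _ => 0
  | n + 1, ω => (1 + srStat L n ω) * L (ω n)

theorem measurable_eval_obsFiltration {n i : ℕ} (h : i < n) :
    Measurable[obsFiltration n] fun ω : ℕ → ℝ => ω i := by
  have h1 : Measurable[obsFiltration n] ((Finset.range n).restrict : (ℕ → ℝ) → _) :=
    comap_measurable _
  exact (measurable_pi_apply (⟨i, Finset.mem_range.2 h⟩ : Finset.range n)).comp h1

theorem measurable_srStat {L : ℝ → ℝ} (hL : Measurable L) (n : ℕ) :
    Measurable[obsFiltration n] (srStat L n) := by
  induction n with
  | zero => exact measurable_const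
  | succ n ih =>
    have h1 : Measurable[obsFiltration (n + 1)] (srStat L n) :=
      ih.mono (obsFiltration.mono n.le_succ) le_rfl
    exact (h1.const_add 1).mul (hL.comp (measurable_eval_obsFiltration n.lt_succ_self))

theorem srStat_nonneg {L : ℝ → ℝ} (hL : ∀ x, 0 < L x) (n : ℕ) (ω : ℕ → ℝ) :
    0 ≤ srStat L n ω := by
  induction n with
  | zero => exact le_rfl
  | succ n ih => exact mul_nonneg (by linarith) (hL _).le

/-! ### Factorization over the past and the next observation. -/

section Independence

variable {P : Measure ℝ} [IsProbabilityMeasure P]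

theorem indepFun_eval {n : ℕ} {u : (ℕ → ℝ) → ℝ} (hu : Measurable[obsFiltration n] u)
    {h : ℝ → ℝ} (hh : Measurable h) :
    IndepFun u (fun ω => h (ω n)) (Measure.infinitePi fun _ : ℕ => P) := by
  have h1 : iIndepFun (fun (i : ℕ) (ω : ℕ → ℝ) => ω i) (Measure.infinitePi fun _ : ℕ => P) :=
    iIndepFun_infinitePi (X := fun _ x => x) (fun _ => measurable_id)
  have h2 := h1.indepFun_finset (Finset.range n) {n} (by simp) (fun i => measurable_pi_apply i)
  have h3 : IndepFun ((Finset.range n).restrict : (ℕ → ℝ) → _) (fun ω : ℕ → ℝ => h (ω n))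
      (Measure.infinitePi fun _ : ℕ => P) :=
    h2.comp (φ := id)
      (ψ := fun y : ({n} : Finset ℕ) → ℝ => h (y ⟨n, Finset.mem_singleton_self n⟩))
      measurable_id (hh.comp (measurable_pi_apply _))
  rw [IndepFun_iff_Indep] at h3 ⊢
  exact indep_of_indep_of_le_left h3 hu.comap_le

theorem integrable_comp_eval_infinitePi {h : ℝ → ℝ} (hi : Integrable h P) (n : ℕ) :
    Integrable (fun ω : ℕ → ℝ => h (ω n)) (Measure.infinitePi fun _ : ℕ => P) :=
  (measurePreserving_eval_infinitePi (fun _ : ℕ => P) n).integrable_comp_of_integrable hi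

theorem integrable_mul_eval {n : ℕ} {u : (ℕ → ℝ) → ℝ} (hu : Measurable[obsFiltration n] u)
    (hui : Integrable u (Measure.infinitePi fun _ : ℕ => P))
    {h : ℝ → ℝ} (hh : Measurable h) (hi : Integrable h P) :
    Integrable (fun ω => u ω * h (ω n)) (Measure.infinitePi fun _ : ℕ => P) :=
  (indepFun_eval hu hh).integrable_mul hui (integrable_comp_eval_infinitePi hi n)

theorem setIntegral_mul_eval {n : ℕ} {A : Set (ℕ → ℝ)} (hA : MeasurableSet[obsFiltration n] A)
    {u : (ℕ → ℝ) → ℝ} (hu : Measurable[obsFiltration n] u)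
    {h : ℝ → ℝ} (hh : Measurable h) :
    ∫ ω in A, u ω * h (ω n) ∂(Measure.infinitePi fun _ : ℕ => P) =
      (∫ ω in A, u ω ∂(Measure.infinitePi fun _ : ℕ => P)) * ∫ x, h x ∂P := by
  have hA' : MeasurableSet A := obsFiltration.le n _ hA
  have h1 : Measurable[obsFiltration n] (A.indicator u) := hu.indicator hA
  rw [← integral_indicator hA', ← integral_indicator hA']
  have h2 : A.indicator (fun ω => u ω * h (ω n)) = A.indicator u * fun ω => h (ω n) := by
    funext ω
    by_cases hω : ω ∈ A <;> simp [hω]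
  rw [h2, (indepFun_eval h1 hh).integral_mul_eq_mul_integral
    (h1.mono (obsFiltration.le n) le_rfl).aestronglyMeasurable
    (hh.comp (measurable_pi_apply n)).aestronglyMeasurable]
  congr 1
  have := (measurePreserving_eval_infinitePi (fun _ : ℕ => P) n)
  conv_rhs => rw [← this.map_eq]
  rw [integral_map (measurable_pi_apply n).aemeasurable hh.aestronglyMeasurable]

end Independence

/-! ### Optional stopping by telescoping over survival events. -/

section Telescoping

/-- The index `j` is the first exit time from the decreasing sets `A n`, capped at `m`; it does not
depend on the process `u`. -/
theorem exists_stopped_index {Ω : Type*} {A : ℕ → Set Ω} (hA : Antitone A) (ω : Ω) (m : ℕ) :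
    ∃ j, ∀ u : ℕ → Ω → ℝ,
      ∑ n ∈ Finset.range m, (A n).indicator (fun ω => u (n + 1) ω - u n ω) ω = u j ω - u 0 ω := by
  -- The induction must remember whether the path has already left: either `j = m`, or `ω` is
  -- outside `A j` and hence outside all later sets.
  suffices h : ∃ j ≤ m, (j = m ∨ ω ∉ A j) ∧ ∀ u : ℕ → Ω → ℝ,
      ∑ n ∈ Finset.range m, (A n).indicator (fun ω => u (n + 1) ω - u n ω) ω = u j ω - u 0 ω by
    obtain ⟨j, -, -, h⟩ := h
    exact ⟨j, h⟩
  induction m with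
  | zero => exact ⟨0, le_rfl, Or.inl rfl, fun u => by simp⟩
  | succ m ih =>
    obtain ⟨j, hj, hj', h⟩ := ih
    by_cases hω : ω ∈ A m
    · have : j = m := hj'.resolve_right (not_not_intro (hA hj hω))
      subst this
      refine ⟨j + 1, le_rfl, Or.inl rfl, fun u => ?_⟩
      rw [Finset.sum_range_succ, h u, Set.indicator_of_mem hω]
      ring
    · refine ⟨j, hj.trans m.le_succ, Or.inr ?_, fun u => ?_⟩
      · rcases hj' with rfl | hj'
        exacts [hω, hj']
      · rw [Finset.sum_range_succ, h u, Set.indicator_of_notMem hω, add_zero]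

theorem le_sum_setIntegral_sub {Ω : Type*} [MeasurableSpace Ω] {μ : Measure Ω}
    [IsProbabilityMeasure μ] {A : ℕ → Set Ω} (hA : Antitone A) (hAm : ∀ n, MeasurableSet (A n))
    {u : ℕ → Ω → ℝ} (hu : ∀ n, Integrable (u n) μ) {c : ℝ} (hc : ∀ n ω, c ≤ u n ω - u 0 ω)
    (m : ℕ) : c ≤ ∑ n ∈ Finset.range m, ∫ ω in A n, (u (n + 1) ω - u n ω) ∂μ := by
  have hi : ∀ n, Integrable ((A n).indicator fun ω => u (n + 1) ω - u n ω) μ := fun n =>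
    ((hu (n + 1)).sub (hu n)).indicator (hAm n)
  simp_rw [← fun n => integral_indicator (μ := μ) (f := fun ω => u (n + 1) ω - u n ω) (hAm n)]
  rw [← integral_finsetSum _ fun n _ => hi n]
  calc c = ∫ _, c ∂μ := by simp
    _ ≤ _ := by
      refine integral_mono (integrable_const c) (integrable_finsetSum _ fun n _ => hi n) fun ω => ?_
      obtain ⟨j, hj⟩ := exists_stopped_index hA ω m
      have := hj u
      simp only [this]
      exact hc j ω

end Telescoping

/-! ### One-step drifts of `R`, `R log R` and `√(1 + R)` without change. -/

section Drift

variable {P : Measure ℝ} [IsProbabilityMeasure P] {L : ℝ → ℝ}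

theorem integrable_srStat (hL : Measurable L) (hLi : Integrable L P) (n : ℕ) :
    Integrable (srStat L n) (Measure.infinitePi fun _ : ℕ => P) := by
  induction n with
  | zero => exact integrable_zero _ _ _
  | succ n ih =>
    exact integrable_mul_eval ((measurable_srStat hL n).const_add 1)
      ((integrable_const 1).add ih) hL hLi

/-- This is the martingale property of `R_n - n`: given the past, `L` has mean one, so `R` has drift
one. -/
theorem setIntegral_srStat_sub (hL : Measurable L) (hLi : Integrable L P) (hL1 : ∫ x, L x ∂P = 1)
    {n : ℕ} {A : Set (ℕ → ℝ)} (hA : MeasurableSet[obsFiltration n] A) :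
    ∫ ω in A, (srStat L (n + 1) ω - srStat L n ω) ∂(Measure.infinitePi fun _ : ℕ => P) =
      (Measure.infinitePi fun _ : ℕ => P).real A := by
  have h1 := (integrable_srStat hL hLi n).integrableOn (s := A)
  have h2 : ∫ ω in A, srStat L (n + 1) ω ∂(Measure.infinitePi fun _ : ℕ => P) =
      ∫ ω in A, (1 + srStat L n ω) ∂(Measure.infinitePi fun _ : ℕ => P) := by
    have := setIntegral_mul_eval (P := P) hA ((measurable_srStat hL n).const_add 1) hL
    rw [hL1, mul_one] at this
    exact this
  rw [integral_sub (integrable_srStat hL hLi (n + 1)).integrableOn h1, h2,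
    integral_add (integrable_const _) h1]
  simp

theorem mul_log_one_add_le {r : ℝ} (hr : 0 ≤ r) :
    (1 + r) * Real.log (1 + r) ≤ r * Real.log r + Real.log (1 + r) + 1 := by
  rcases hr.eq_or_lt with rfl | hr
  · simp
  · have h1 : Real.log ((1 + r) / r) ≤ (1 + r) / r - 1 := Real.log_le_sub_one_of_pos (by positivity)
    rw [Real.log_div (by positivity) hr.ne'] at h1
    have h2 : r * (Real.log (1 + r) - Real.log r) ≤ r * ((1 + r) / r - 1) :=
      mul_le_mul_of_nonneg_left h1 hr.le
    have h3 : r * ((1 + r) / r - 1) = 1 := by field_simp; ring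
    linarith

theorem mul_log_srStat_succ (hLp : ∀ x, 0 < L x) (n : ℕ) (ω : ℕ → ℝ) :
    srStat L (n + 1) ω * Real.log (srStat L (n + 1) ω) =
      (1 + srStat L n ω) * Real.log (1 + srStat L n ω) * L (ω n) +
        (1 + srStat L n ω) * (L (ω n) * Real.log (L (ω n))) := by
  have h := srStat_nonneg hLp n ω
  rw [srStat, Real.log_mul (by positivity) (hLp _).ne']
  ring

theorem integrable_one_add_mul_log {Ω : Type*} [MeasurableSpace Ω] {μ : Measure Ω}
    [IsFiniteMeasure μ] {R : Ω → ℝ} (hR0 : ∀ ω, 0 ≤ R ω) (hRm : Measurable R)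
    (hR : Integrable R μ) (hRl : Integrable (fun ω => R ω * Real.log (R ω)) μ) :
    Integrable (fun ω => (1 + R ω) * Real.log (1 + R ω)) μ := by
  refine ((hRl.add hR).add (integrable_const 1)).mono'
    ((hRm.const_add 1).mul (hRm.const_add 1).log).aestronglyMeasurable
    (Filter.Eventually.of_forall fun ω => ?_)
  have h0 : 0 ≤ Real.log (1 + R ω) := Real.log_nonneg (by linarith [hR0 ω])
  have h1 : Real.log (1 + R ω) ≤ 1 + R ω - 1 :=
    Real.log_le_sub_one_of_pos (by linarith [hR0 ω])
  rw [Real.norm_of_nonneg (mul_nonneg (by linarith [hR0 ω]) h0)]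
  have := mul_log_one_add_le (hR0 ω)
  simp only [Pi.add_apply]
  linarith

theorem integrable_srStat_mul_log (hL : Measurable L) (hLp : ∀ x, 0 < L x) (hLi : Integrable L P)
    (hLl : Integrable (fun x => L x * Real.log (L x)) P) (n : ℕ) :
    Integrable (fun ω => srStat L n ω * Real.log (srStat L n ω))
      (Measure.infinitePi fun _ : ℕ => P) := by
  induction n with
  | zero => simp [srStat]
  | succ n ih =>
    simp_rw [mul_log_srStat_succ hLp]
    have hm := (measurable_srStat hL n).const_add 1
    have hR := integrable_srStat hL hLi n (P := P)
    exact (integrable_mul_eval (hm.mul hm.log) (integrable_one_add_mul_log (srStat_nonneg hLp n)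
      ((measurable_srStat hL n).mono (obsFiltration.le n) le_rfl) hR ih) hL hLi).add
      (integrable_mul_eval (h := fun x => L x * Real.log (L x)) hm ((integrable_const 1).add hR)
        (hL.mul hL.log) hLl)

theorem integrable_sqrt_one_add_srStat (hL : Measurable L) (hLp : ∀ x, 0 < L x)
    (hLi : Integrable L P) (n : ℕ) :
    Integrable (fun ω => √(1 + srStat L n ω)) (Measure.infinitePi fun _ : ℕ => P) := by
  have hR1 := (integrable_const 1).add (integrable_srStat hL hLi n (P := P))
  have hm := ((measurable_srStat hL n).const_add 1).mono (obsFiltration.le n) le_rfl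
  refine hR1.mono' hm.sqrt.aestronglyMeasurable (Filter.Eventually.of_forall fun ω => ?_)
  rw [Real.norm_of_nonneg (Real.sqrt_nonneg _)]
  exact Real.sqrt_le_self_iff.2 (Or.inr (by linarith [srStat_nonneg hLp n ω]))

/-- Averaging `mul_log_srStat_succ` over the next observation replaces `L` by one and `L log L` by
the information number. The remaining difference `(1 + R) log (1 + R) - R log R` is at most `log (1
+ R) + 1`, and the logarithm is dominated by a square root. -/
theorem setIntegral_mul_log_sub_le (hL : Measurable L) (hLp : ∀ x, 0 < L x)
    (hLi : Integrable L P) (hL1 : ∫ x, L x ∂P = 1)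
    (hLl : Integrable (fun x => L x * Real.log (L x)) P)
    {n : ℕ} {A : Set (ℕ → ℝ)} (hA : MeasurableSet[obsFiltration n] A) :
    ∫ ω in A, (srStat L (n + 1) ω * Real.log (srStat L (n + 1) ω) -
        srStat L n ω * Real.log (srStat L n ω)) ∂(Measure.infinitePi fun _ : ℕ => P) ≤
      (∫ x, L x * Real.log (L x) ∂P) *
          (∫ ω in A, (1 + srStat L n ω) ∂(Measure.infinitePi fun _ : ℕ => P)) +
        (2 * (∫ ω in A, √(1 + srStat L n ω) ∂(Measure.infinitePi fun _ : ℕ => P)) +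
          (Measure.infinitePi fun _ : ℕ => P).real A) := by
  set μ := Measure.infinitePi fun _ : ℕ => P
  have hm := (measurable_srStat hL n).const_add 1
  have hR := integrable_srStat hL hLi n (P := P)
  have hR1 : Integrable (fun ω => 1 + srStat L n ω) μ := (integrable_const 1).add hR
  have hl := integrable_srStat_mul_log hL hLp hLi hLl n (P := P)
  have hl1 := integrable_one_add_mul_log (srStat_nonneg hLp n)
    ((measurable_srStat hL n).mono (obsFiltration.le n) le_rfl) hR hl
  have hi1 : Integrable (fun ω => (1 + srStat L n ω) * Real.log (1 + srStat L n ω) * L (ω n)) μ :=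
    integrable_mul_eval (hm.mul hm.log) hl1 hL hLi
  have hi2 := integrable_mul_eval (h := fun x => L x * Real.log (L x)) hm hR1
    (hL.mul hL.log) hLl
  have e1 := setIntegral_mul_eval (P := P) hA (hm.mul hm.log) hL
  have e2 := setIntegral_mul_eval (P := P) (h := fun x => L x * Real.log (L x)) hA hm
    (hL.mul hL.log)
  rw [hL1, mul_one] at e1
  have hsq := integrable_sqrt_one_add_srStat hL hLp hLi n (P := P)
  rw [integral_sub (integrable_srStat_mul_log hL hLp hLi hLl (n + 1)).integrableOn hl.integrableOn]
  simp_rw [mul_log_srStat_succ hLp]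
  rw [integral_add hi1.integrableOn hi2.integrableOn]
  have key : ∫ ω in A, ((1 + srStat L n ω) * Real.log (1 + srStat L n ω) -
      srStat L n ω * Real.log (srStat L n ω)) ∂μ ≤ ∫ ω in A, (2 * √(1 + srStat L n ω) + 1) ∂μ := by
    refine integral_mono (hl1.sub hl).integrableOn
      ((hsq.const_mul 2).add (integrable_const 1)).integrableOn fun ω => ?_
    have h0 := srStat_nonneg hLp n ω
    have h1 := mul_log_one_add_le h0
    -- Apply `log y ≤ y - 1` at `y = √(1 + R)`.
    have h2 : Real.log (1 + srStat L n ω) ≤ 2 * √(1 + srStat L n ω) := by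
      have h3 : 0 < √(1 + srStat L n ω) := Real.sqrt_pos.2 (by linarith)
      have h4 := Real.log_le_sub_one_of_pos h3
      rw [Real.log_sqrt (by linarith)] at h4
      linarith
    simp only
    linarith
  rw [integral_sub hl1.integrableOn hl.integrableOn,
    integral_add (hsq.const_mul 2).integrableOn (integrable_const 1), integral_const_mul] at key
  have e1' : ∫ ω in A, (1 + srStat L n ω) * Real.log (1 + srStat L n ω) * L (ω n) ∂μ =
      ∫ ω in A, (1 + srStat L n ω) * Real.log (1 + srStat L n ω) ∂μ := e1
  have e2' : ∫ ω in A, (1 + srStat L n ω) * (L (ω n) * Real.log (L (ω n))) ∂μ =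
      (∫ ω in A, (1 + srStat L n ω) ∂μ) * ∫ x, L x * Real.log (L x) ∂P := e2
  rw [e1', e2']
  simp only [integral_const, MeasurableSet.univ, measureReal_restrict_apply, Set.univ_inter,
    smul_eq_mul, mul_one] at key
  linarith

theorem integrable_sqrt_of_integrable (hL : Measurable L) (hLp : ∀ x, 0 < L x)
    (hLi : Integrable L P) : Integrable (fun x => √(L x)) P := by
  refine ((integrable_const 1).add hLi).mono' hL.sqrt.aestronglyMeasurable
    (Filter.Eventually.of_forall fun x => ?_)
  rw [Real.norm_of_nonneg (Real.sqrt_nonneg _)]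
  simp only [Pi.add_apply]
  nlinarith [Real.sq_sqrt (hLp x).le, sq_nonneg (√(L x) - 1), hLp x]

/-- Subadditivity of the root gives `√(1 + (1 + R) L) ≤ 1 + √(1 + R) √L`, so the mean of `√(1 + R)`
contracts by the factor `∫ √L`, up to an additive one. -/
theorem setIntegral_sqrt_sub_le (hL : Measurable L) (hLp : ∀ x, 0 < L x)
    (hLi : Integrable L P)
    {n : ℕ} {A : Set (ℕ → ℝ)} (hA : MeasurableSet[obsFiltration n] A) :
    ∫ ω in A, (√(1 + srStat L (n + 1) ω) - √(1 + srStat L n ω))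
        ∂(Measure.infinitePi fun _ : ℕ => P) ≤
      (Measure.infinitePi fun _ : ℕ => P).real A - (1 - ∫ x, √(L x) ∂P) *
          (∫ ω in A, √(1 + srStat L n ω) ∂(Measure.infinitePi fun _ : ℕ => P)) := by
  set μ := Measure.infinitePi fun _ : ℕ => P
  have hm := ((measurable_srStat hL n).const_add 1).sqrt
  have hs := integrable_sqrt_one_add_srStat hL hLp hLi (P := P)
  have hsL := integrable_sqrt_of_integrable hL hLp hLi
  have hi := integrable_mul_eval (h := fun x => √(L x)) hm (hs n) hL.sqrt hsL
  have e := setIntegral_mul_eval (P := P) (h := fun x => √(L x)) hA hm hL.sqrt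
  have key : ∫ ω in A, √(1 + srStat L (n + 1) ω) ∂μ ≤
      ∫ ω in A, (1 + √(1 + srStat L n ω) * √(L (ω n))) ∂μ := by
    refine integral_mono (hs (n + 1)).integrableOn
      ((integrable_const 1).add hi).integrableOn fun ω => ?_
    have h0 := srStat_nonneg hLp n ω
    simp only
    rw [← Real.sqrt_mul (by linarith)]
    have h1 : 0 ≤ (1 + srStat L n ω) * L (ω n) := mul_nonneg (by linarith) (hLp _).le
    rw [srStat, Real.sqrt_le_iff]
    refine ⟨by positivity, ?_⟩
    nlinarith [Real.sq_sqrt h1, Real.sqrt_nonneg ((1 + srStat L n ω) * L (ω n))]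
  rw [integral_add (integrable_const 1) hi.integrableOn, e] at key
  rw [integral_sub (hs (n + 1)).integrableOn (hs n).integrableOn]
  simp only [integral_const, MeasurableSet.univ, measureReal_restrict_apply, Set.univ_inter,
    smul_eq_mul, mul_one] at key
  linarith

/-- The lower bound on the integrated Shiryaev–Roberts statistic up to a bounded stopping time
with survival events `A n`, in terms of the mean `a` of the stopping time. -/
theorem mul_log_le_of_survival (hL : Measurable L) (hLp : ∀ x, 0 < L x) (hLi : Integrable L P)
    (hL1 : ∫ x, L x ∂P = 1) (hLl : Integrable (fun x => L x * Real.log (L x)) P)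
    (hρ : ∫ x, √(L x) ∂P < 1) {A : ℕ → Set (ℕ → ℝ)} (hA : Antitone A)
    (hAm : ∀ n, MeasurableSet[obsFiltration n] (A n)) (m : ℕ) {a : ℝ}
    (ha : a = ∑ n ∈ Finset.range m, (Measure.infinitePi fun _ : ℕ => P).real (A n))
    (ha1 : 1 ≤ a) :
    a * Real.log a ≤ (∫ x, L x * Real.log (L x) ∂P) *
        (∑ n ∈ Finset.range m,
          ∫ ω in A n, (1 + srStat L n ω) ∂(Measure.infinitePi fun _ : ℕ => P)) +
      (1 + 4 / (1 - ∫ x, √(L x) ∂P)) * a := by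
  set μ := Measure.infinitePi fun _ : ℕ => P
  set ρ := ∫ x, √(L x) ∂P
  have hAm' : ∀ n, MeasurableSet (A n) := fun n => obsFiltration.le n _ (hAm n)
  have hR := integrable_srStat hL hLi (P := P)
  have hl := integrable_srStat_mul_log hL hLp hLi hLl (P := P)
  have hs := integrable_sqrt_one_add_srStat hL hLp hLi (P := P)
  have a0 : 0 < a := by linarith
  -- The constant `-1` comes from `√(1 + R_0) = 1` and nonnegativity of the root.
  have s1 := le_sum_setIntegral_sub hA hAm' hs (c := -1) (fun n ω => by
    have := Real.sqrt_nonneg (1 + srStat L n ω)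
    simp only [srStat, add_zero, Real.sqrt_one]
    linarith) m
  have s2 := s1.trans (Finset.sum_le_sum fun n _ => setIntegral_sqrt_sub_le hL hLp hLi (hAm n))
  rw [Finset.sum_sub_distrib, ← Finset.mul_sum, ← ha] at s2
  have r1 : ∑ n ∈ Finset.range m, ∫ ω in A n, (srStat L (n + 1) ω - srStat L n ω) ∂μ = a := by
    rw [ha]
    exact Finset.sum_congr rfl fun n _ => setIntegral_srStat_sub hL hLi hL1 (hAm n)
  -- Jensen's inequality via a tangent line: at `r = a` the tangent to `r log r` is `(1 + log a) r -
  -- a`. Subtracting its linear part leaves a process bounded below by `-a`.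
  have t1 := le_sum_setIntegral_sub hA hAm' (c := -a)
    (u := fun n ω => srStat L n ω * Real.log (srStat L n ω) - (1 + Real.log a) * srStat L n ω)
    (fun n => (hl n).sub ((hR n).const_mul _)) (fun n ω => by
      simp only [srStat, zero_mul, mul_zero, sub_zero]
      rcases (srStat_nonneg hLp n ω).eq_or_lt with h | h
      · rw [← h]
        simp [a0.le]
      · have h1 := Real.log_le_sub_one_of_pos (div_pos a0 h)
        rw [Real.log_div a0.ne' h.ne'] at h1
        have h2 := mul_le_mul_of_nonneg_left h1 h.le
        have h3 : srStat L n ω * (a / srStat L n ω - 1) = a - srStat L n ω := by field_simp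
        linarith) m
  have t2 : ∑ n ∈ Finset.range m, ∫ ω in A n, (srStat L (n + 1) ω * Real.log (srStat L (n + 1) ω) -
        (1 + Real.log a) * srStat L (n + 1) ω - (srStat L n ω * Real.log (srStat L n ω) -
        (1 + Real.log a) * srStat L n ω)) ∂μ =
      ∑ n ∈ Finset.range m, ∫ ω in A n, (srStat L (n + 1) ω * Real.log (srStat L (n + 1) ω) -
        srStat L n ω * Real.log (srStat L n ω)) ∂μ - (1 + Real.log a) * a := by
    generalize 1 + Real.log a = c
    rw [← r1, Finset.mul_sum, ← Finset.sum_sub_distrib]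
    refine Finset.sum_congr rfl fun n _ => ?_
    have i1 : Integrable (fun ω => srStat L (n + 1) ω * Real.log (srStat L (n + 1) ω) -
      srStat L n ω * Real.log (srStat L n ω)) μ := (hl (n + 1)).sub (hl n)
    have i2 : Integrable (fun ω => c * (srStat L (n + 1) ω - srStat L n ω)) μ :=
      ((hR (n + 1)).sub (hR n)).const_mul c
    rw [← integral_const_mul, ← integral_sub i1.integrableOn i2.integrableOn]
    refine integral_congr_ae (Filter.Eventually.of_forall fun ω => ?_)
    simp only
    ring
  rw [t2] at t1
  have t3 := Finset.sum_le_sum fun n (_ : n ∈ Finset.range m) =>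
    setIntegral_mul_log_sub_le hL hLp hLi hL1 hLl (hAm n)
  rw [Finset.sum_add_distrib, Finset.sum_add_distrib, ← Finset.mul_sum, ← Finset.mul_sum,
    ← ha] at t3
  have hρ' : 0 < 1 - ρ := by linarith
  -- The Lyapunov bound is `(a + 1)/(1 - ρ)`; `1 ≤ a` absorbs the one.
  have s3 : ∑ n ∈ Finset.range m, ∫ ω in A n, √(1 + srStat L n ω) ∂μ ≤ 2 * a / (1 - ρ) := by
    rw [le_div_iff₀ hρ']
    linarith
  have s4 : 4 / (1 - ρ) * a = 2 * (2 * a / (1 - ρ)) := by ring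
  linarith

end Drift

/-! ### Change of measure on finitely many coordinates. -/

section ChangeOfMeasure

variable {P : Measure ℝ} [IsProbabilityMeasure P] {g : ℝ → ℝ≥0∞}

theorem infinitePi_withDensity_prod (hg : Measurable g) [IsProbabilityMeasure (P.withDensity g)]
    (J : Finset ℕ) :
    (Measure.infinitePi fun _ : ℕ => P).withDensity (fun ω => ∏ i ∈ J, g (ω i)) =
      Measure.infinitePi fun i : ℕ => if i ∈ J then P.withDensity g else P := by
  have hpr : ∀ i : ℕ, IsProbabilityMeasure (if i ∈ J then P.withDensity g else P) := fun i => by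
    split_ifs <;> infer_instance
  have hg1 : ∫⁻ x, g x ∂P = 1 := by
    rw [← setLIntegral_univ, ← withDensity_apply _ MeasurableSet.univ, measure_univ]
  refine Measure.eq_infinitePi _ fun s t ht => ?_
  -- On a cylinder both the event and the density are products over coordinates; `φ i` collects the
  -- factors at `i`. Coordinates in `J` outside the cylinder's support integrate to one.
  set φ : ℕ → ℝ → ℝ≥0∞ := fun i x =>
    (if i ∈ s then (t i).indicator 1 x else 1) * (if i ∈ J then g x else 1)
  have hφ : ∀ i, Measurable (φ i) := fun i => by
    refine Measurable.mul ?_ ?_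
    · split_ifs
      exacts [measurable_one.indicator (ht i), measurable_const]
    · split_ifs
      exacts [hg, measurable_const]
  have hst : MeasurableSet (Set.pi (s : Set ℕ) t) :=
    MeasurableSet.pi s.countable_toSet fun i _ => ht i
  have hφe : ∀ ω : ℕ → ℝ, (Set.pi (s : Set ℕ) t).indicator (fun ω => ∏ i ∈ J, g (ω i)) ω =
      ∏ i ∈ s ∪ J, φ i (ω i) := by
    intro ω
    rw [Finset.prod_mul_distrib, Finset.prod_ite_mem, Finset.prod_ite_mem,
      Finset.inter_eq_right.2 Finset.subset_union_left,
      Finset.inter_eq_right.2 Finset.subset_union_right]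
    by_cases hω : ω ∈ Set.pi (s : Set ℕ) t
    · have h1 : ∏ i ∈ s, (t i).indicator (1 : ℝ → ℝ≥0∞) (ω i) = 1 :=
        Finset.prod_eq_one fun i hi => by simp [hω i hi]
      rw [Set.indicator_of_mem hω, h1, one_mul]
    · rw [Set.indicator_of_notMem hω]
      simp only [Set.mem_pi, not_forall] at hω
      obtain ⟨i, hi, hi'⟩ := hω
      rw [Finset.prod_eq_zero hi (by simp [hi']), zero_mul]
  have hind : iIndepFun (fun (i : ℕ) (ω : ℕ → ℝ) => φ i (ω i))
      (Measure.infinitePi fun _ : ℕ => P) :=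
    iIndepFun_infinitePi (X := φ) hφ
  rw [withDensity_apply _ hst, ← lintegral_indicator hst, lintegral_congr hφe]
  refine (lintegral_prod_eq_prod_lintegral_of_indepFun _ (fun i (ω : ℕ → ℝ) => φ i (ω i)) hind
      fun i => (hφ i).comp (measurable_pi_apply i)).trans ?_
  have hint : ∀ i, ∫⁻ ω, φ i (ω i) ∂(Measure.infinitePi fun _ : ℕ => P) = ∫⁻ x, φ i x ∂P :=
    fun i => (measurePreserving_eval_infinitePi (fun _ : ℕ => P) i).lintegral_comp (hφ i)
  simp_rw [hint]
  have hs : ∀ i ∈ s, (if i ∈ J then P.withDensity g else P) (t i) = ∫⁻ x, φ i x ∂P := by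
    intro i hi
    by_cases hJ : i ∈ J
    · simp only [φ, hi, hJ, if_true]
      rw [withDensity_apply _ (ht i), ← lintegral_indicator (ht i)]
      refine lintegral_congr fun x => ?_
      by_cases hx : x ∈ t i <;> simp [hx]
    · simp [φ, hi, hJ, lintegral_indicator (ht i)]
  rw [Finset.prod_congr rfl hs]
  refine (Finset.prod_subset Finset.subset_union_left fun i hi his => ?_).symm
  have hJ : i ∈ J := by
    rcases Finset.mem_union.1 hi with h | h
    exacts [absurd h his, h]
  simp [φ, his, hJ, hg1]

theorem infinitePi_apply_eq_of_obsFiltration {p q : ℕ → Measure ℝ}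
    [∀ i, IsProbabilityMeasure (p i)] [∀ i, IsProbabilityMeasure (q i)] {n : ℕ}
    (h : ∀ i < n, p i = q i) {B : Set (ℕ → ℝ)} (hB : MeasurableSet[obsFiltration n] B) :
    Measure.infinitePi p B = Measure.infinitePi q B := by
  obtain ⟨C, hC, rfl⟩ := hB
  rw [← Measure.map_apply (Finset.measurable_restrict _) hC,
    ← Measure.map_apply (Finset.measurable_restrict _) hC, Measure.infinitePi_map_restrict,
    Measure.infinitePi_map_restrict]
  congr 2
  funext i
  exact h i (Finset.mem_range.1 i.2)

/-- An event of the first `n` observations does not see later coordinates, so only the post-change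
ones, `Ico k n`, need tilting. -/
theorem infinitePi_change_apply (hg : Measurable g) [IsProbabilityMeasure (P.withDensity g)]
    (k n : ℕ) {B : Set (ℕ → ℝ)} (hB : MeasurableSet[obsFiltration n] B) :
    (Measure.infinitePi fun i : ℕ => if i + 1 < k + 1 then P else P.withDensity g) B =
      ∫⁻ ω in B, ∏ i ∈ Finset.Ico k n, g (ω i) ∂(Measure.infinitePi fun _ : ℕ => P) := by
  rw [← withDensity_apply _ (obsFiltration.le n _ hB), infinitePi_withDensity_prod hg]
  have h1 : ∀ i : ℕ, IsProbabilityMeasure (if i + 1 < k + 1 then P else P.withDensity g) :=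
    fun i => by split_ifs <;> infer_instance
  have h2 : ∀ i : ℕ, IsProbabilityMeasure (if i ∈ Finset.Ico k n then P.withDensity g else P) :=
    fun i => by split_ifs <;> infer_instance
  refine infinitePi_apply_eq_of_obsFiltration (fun i hi => ?_) hB
  by_cases hk : i < k
  · simp [hk]
  · simp [hk, hi, not_lt.1 hk]

end ChangeOfMeasure

/-! ### From conditional delays to the integrated statistic. -/

section Delay

variable {P : Measure ℝ} [IsProbabilityMeasure P] {L : ℝ → ℝ}

/-- The index `k` counts pre-change observations, so the change point is `k + 1`; the term `k = n`
is the empty product and supplies the `1`. -/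
theorem one_add_srStat_eq_sum (L : ℝ → ℝ) (n : ℕ) (ω : ℕ → ℝ) :
    1 + srStat L n ω = ∑ k ∈ Finset.range (n + 1), ∏ i ∈ Finset.Ico k n, L (ω i) := by
  induction n with
  | zero => simp [srStat]
  | succ n ih =>
    rw [Finset.sum_range_succ, srStat, ih, Finset.sum_mul]
    simp only [Finset.Ico_self, Finset.prod_empty]
    rw [add_comm]
    congr 1
    refine Finset.sum_congr rfl fun k hk => ?_
    rw [Finset.prod_Ico_succ_top (Nat.lt_succ_iff.1 (Finset.mem_range.1 hk))]

theorem sum_indicator_le_delay (N : (ℕ → ℝ) → ℕ∞) (k m : ℕ) (ω : ℕ → ℝ) :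
    ∑ n ∈ Finset.Ico k m, {ω | (n : ℕ∞) < N ω}.indicator (1 : (ℕ → ℝ) → ℝ≥0∞) ω ≤
      ((N ω + 1 - ((k + 1 : ℕ) : ℕ∞) : ℕ∞) : ℝ≥0∞) := by
  have h : ∑ n ∈ Finset.Ico k m, {ω | (n : ℕ∞) < N ω}.indicator (1 : (ℕ → ℝ) → ℝ≥0∞) ω =
      (((Finset.Ico k m).filter fun n : ℕ => (n : ℕ∞) < N ω).card : ℝ≥0∞) := by
    classical
    simp [Set.indicator_apply]
  rw [h]
  have h2 : (((Finset.Ico k m).filter fun n : ℕ => (n : ℕ∞) < N ω).card : ℕ∞) ≤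
      N ω + 1 - ((k + 1 : ℕ) : ℕ∞) := by
    cases hN : N ω with
    | top => rw [top_add, ENat.top_sub_natCast]; exact le_top
    | coe a =>
      have : (Finset.Ico k m).filter (fun n : ℕ => (n : ℕ∞) < (a : ℕ∞)) ⊆ Finset.Ico k a := by
        intro i hi
        simp only [Finset.mem_filter, Finset.mem_Ico, Nat.cast_lt] at hi ⊢
        exact ⟨hi.1.1, hi.2⟩
      have := Finset.card_le_card this
      rw [Nat.card_Ico] at this
      have h3 : (a : ℕ∞) + 1 - ((k + 1 : ℕ) : ℕ∞) = ((a - k : ℕ) : ℕ∞) := by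
        rw [← Nat.add_sub_add_right a 1 k, ENat.natCast_sub, Nat.cast_add a 1, Nat.cast_one]
      rw [h3]
      exact_mod_cast this
  exact_mod_cast h2

theorem measurableSet_lt_stopping {N : (ℕ → ℝ) → ℕ∞} (hN : IsStoppingTime obsFiltration N)
    (n : ℕ) : MeasurableSet[obsFiltration n] {ω | (n : ℕ∞) < N ω} := by
  have : {ω | (n : ℕ∞) < N ω} = {ω | N ω ≤ (n : ℕ∞)}ᶜ := by
    ext ω
    simp
  rw [this]
  exact (hN n).compl

theorem setLIntegral_le_of_essSup_condLExp_le {Ω : Type*} {m m0 : MeasurableSpace Ω}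
    {μ : Measure[m0] Ω} [IsFiniteMeasure μ] (hm : m ≤ m0) {X : Ω → ℝ≥0∞} {D : ℝ≥0∞}
    (h : essSup (condLExp m μ X) μ ≤ D) {s : Set Ω} (hs : MeasurableSet[m] s) :
    ∫⁻ ω in s, X ω ∂μ ≤ D * μ s := by
  rw [← setLIntegral_condLExp hm μ X hs, ← setLIntegral_const]
  refine lintegral_mono_ae (ae_restrict_of_ae ?_)
  filter_upwards [ENNReal.ae_le_essSup (condLExp m μ X) (μ := μ)] with ω hω
  exact hω.trans h

/-- A bound on the conditional detection delays bounds the integrated Shiryaev–Roberts statistic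
up to the stopping time. -/
theorem sum_lintegral_srStat_le (hL : Measurable L) (hLp : ∀ x, 0 < L x)
    [IsProbabilityMeasure (P.withDensity fun x => ENNReal.ofReal (L x))]
    {N : (ℕ → ℝ) → ℕ∞} (hN : IsStoppingTime obsFiltration N) {D : ℝ≥0∞}
    (hD : ∀ k : ℕ, essSup (condLExp (obsFiltration k)
      (Measure.infinitePi fun i : ℕ =>
        if i + 1 < k + 1 then P else P.withDensity fun x => ENNReal.ofReal (L x))
      fun ω => ((N ω + 1 - ((k + 1 : ℕ) : ℕ∞) : ℕ∞) : ℝ≥0∞))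
      (Measure.infinitePi fun i : ℕ =>
        if i + 1 < k + 1 then P else P.withDensity fun x => ENNReal.ofReal (L x)) ≤ D)
    (m : ℕ) :
    ∑ n ∈ Finset.range m, ∫⁻ ω in {ω | (n : ℕ∞) < N ω}, ENNReal.ofReal (1 + srStat L n ω)
        ∂(Measure.infinitePi fun _ : ℕ => P) ≤
      D * ∑ n ∈ Finset.range m, (Measure.infinitePi fun _ : ℕ => P) {ω | (n : ℕ∞) < N ω} := by
  set μ := Measure.infinitePi fun _ : ℕ => P
  set g : ℝ → ℝ≥0∞ := fun x => ENNReal.ofReal (L x)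
  have hg : Measurable g := hL.ennreal_ofReal
  set A : ℕ → Set (ℕ → ℝ) := fun n => {ω | (n : ℕ∞) < N ω}
  have hAm := measurableSet_lt_stopping hN
  have hAm' : ∀ n, MeasurableSet (A n) := fun n => obsFiltration.le n _ (hAm n)
  have hpr : ∀ k i : ℕ, IsProbabilityMeasure (if i + 1 < k + 1 then P else P.withDensity g) :=
    fun k i => by split_ifs <;> infer_instance
  have step : ∀ k ∈ Finset.range m,
      ∑ n ∈ Finset.Ico k m, ∫⁻ ω in A n, ∏ i ∈ Finset.Ico k n, g (ω i) ∂μ ≤ D * μ (A k) := by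
    intro k hk
    have hprk := hpr k
    -- Survival past `k` depends only on pre-change observations, so both laws give it the same
    -- probability.
    have e0 : μ (A k) = (Measure.infinitePi fun i : ℕ =>
        if i + 1 < k + 1 then P else P.withDensity g) (A k) :=
      infinitePi_apply_eq_of_obsFiltration (fun i hi => by simp [hi]) (hAm k)
    rw [e0]
    refine le_trans ?_ (setLIntegral_le_of_essSup_condLExp_le (obsFiltration.le k) (hD k) (hAm k))
    refine le_trans ?_ (lintegral_mono fun ω => sum_indicator_le_delay N k m ω)
    rw [lintegral_finsetSum _ fun n _ => measurable_one.indicator (hAm' n)]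
    refine Finset.sum_le_sum fun n hn => ?_
    rw [← infinitePi_change_apply hg k n (hAm n), lintegral_indicator_one (hAm' n),
      Measure.restrict_apply (hAm' n)]
    refine measure_mono fun ω hω => ⟨hω, ?_⟩
    have hkn : (k : ℕ∞) ≤ n := by exact_mod_cast (Finset.mem_Ico.1 hn).1
    exact hkn.trans_lt hω
  rw [Finset.mul_sum]
  refine le_trans (le_of_eq ?_) (Finset.sum_le_sum step)
  have e1 : ∀ n, ∫⁻ ω in A n, ENNReal.ofReal (1 + srStat L n ω) ∂μ =
      ∑ k ∈ Finset.range (n + 1), ∫⁻ ω in A n, ∏ i ∈ Finset.Ico k n, g (ω i) ∂μ := by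
    intro n
    rw [← lintegral_finsetSum]
    · refine lintegral_congr fun ω => ?_
      rw [one_add_srStat_eq_sum, ENNReal.ofReal_sum_of_nonneg fun k _ =>
        Finset.prod_nonneg fun i _ => (hLp _).le]
      refine Finset.sum_congr rfl fun k _ => ?_
      rw [ENNReal.ofReal_prod_of_nonneg fun i _ => (hLp _).le]
    · intro k _
      exact Finset.measurable_prod _ fun i _ => hg.comp (measurable_pi_apply i)
  rw [Finset.sum_congr rfl fun n _ => e1 n]
  -- Both double sums run over `k ≤ n < m`.
  refine Finset.sum_comm' fun n k => ?_
  simp only [Finset.mem_range, Finset.mem_Ico]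
  omega

end Delay

/-! ### Strict inequalities for `L` and the bound on the mean of `N`. -/

section LikelihoodRatio

variable {P : Measure ℝ} [IsProbabilityMeasure P] {L : ℝ → ℝ}

/-- The Hellinger identity `∫ (√L - 1)² = 2 - 2 ∫ √L` makes equality force `L = 1` almost
everywhere. -/
theorem integral_sqrt_lt_one (hL : Measurable L) (hLp : ∀ x, 0 < L x) (hLi : Integrable L P)
    (hL1 : ∫ x, L x ∂P = 1) (hne : ¬ ∀ᵐ x ∂P, L x = 1) : ∫ x, √(L x) ∂P < 1 := by
  have hs := integrable_sqrt_of_integrable hL hLp hLi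
  have e : ∀ x, (√(L x) - 1) ^ 2 = L x + 1 - 2 * √(L x) := fun x => by
    have := Real.sq_sqrt (hLp x).le
    ring_nf
    linarith
  have hi1 : Integrable (fun x => L x + 1) P := hLi.add (integrable_const 1)
  have hi : Integrable (fun x => (√(L x) - 1) ^ 2) P := by
    simp_rw [e]
    exact hi1.sub (hs.const_mul 2)
  have h1 : ∫ x, (√(L x) - 1) ^ 2 ∂P = 2 - 2 * ∫ x, √(L x) ∂P := by
    simp_rw [e]
    rw [integral_sub hi1 (hs.const_mul 2),
      integral_add hLi (integrable_const 1), integral_const_mul, hL1]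
    simp
    norm_num
  have h0 : 0 ≤ ∫ x, (√(L x) - 1) ^ 2 ∂P := integral_nonneg fun x => sq_nonneg _
  by_contra hcon
  have h2 : ∫ x, (√(L x) - 1) ^ 2 ∂P = 0 := by linarith
  rw [integral_eq_zero_iff_of_nonneg (fun x => sq_nonneg _) hi] at h2
  refine hne ?_
  filter_upwards [h2] with x hx
  have h3 : √(L x) = 1 := by
    have := pow_eq_zero_iff (two_ne_zero) |>.1 hx
    linarith
  exact Real.sqrt_eq_one.1 h3

/-- Since `log y ≥ 2 (1 - 1/√y)`, the integral is at least `2 (1 - ∫ √L)`. -/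
theorem integral_mul_log_pos (hL : Measurable L) (hLp : ∀ x, 0 < L x) (hLi : Integrable L P)
    (hL1 : ∫ x, L x ∂P = 1) (hLl : Integrable (fun x => L x * Real.log (L x)) P)
    (hρ : ∫ x, √(L x) ∂P < 1) : 0 < ∫ x, L x * Real.log (L x) ∂P := by
  have hs := integrable_sqrt_of_integrable hL hLp hLi
  have h1 : ∫ x, 2 * (L x - √(L x)) ∂P ≤ ∫ x, L x * Real.log (L x) ∂P := by
    refine integral_mono ((hLi.sub hs).const_mul 2) hLl fun x => ?_
    have hx : 0 < √(L x) := Real.sqrt_pos.2 (hLp x)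
    have h2 := Real.log_le_sub_one_of_pos (inv_pos.2 hx)
    rw [Real.log_inv, Real.log_sqrt (hLp x).le] at h2
    have h3 := mul_le_mul_of_nonneg_left h2 (hLp x).le
    have h4 : L x * (√(L x))⁻¹ = √(L x) := by
      rw [← div_eq_mul_inv, Real.div_sqrt]
    simp only
    linarith
  rw [integral_const_mul, integral_sub hLi hs, hL1] at h1
  linarith

theorem coe_le_tsum_indicator {Ω : Type*} (N : Ω → ℕ∞) (ω : Ω) :
    (N ω : ℝ≥0∞) ≤ ∑' n : ℕ, {ω | (n : ℕ∞) < N ω}.indicator (1 : Ω → ℝ≥0∞) ω := by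
  cases hN : N ω with
  | top => simp [hN]
  | coe a =>
    refine le_trans (le_of_eq ?_) (ENNReal.sum_le_tsum (Finset.range a))
    have h : ∀ n ∈ Finset.range a,
        {ω | (n : ℕ∞) < N ω}.indicator (1 : Ω → ℝ≥0∞) ω = 1 := fun n hn => by
      have hlt : (n : ℕ∞) < N ω := by
        rw [hN]
        exact_mod_cast Finset.mem_range.1 hn
      simp [hlt]
    rw [Finset.sum_congr rfl h]
    simp

theorem setOf_pos_eq_empty_or_univ {N : (ℕ → ℝ) → ℕ∞} (hN : IsStoppingTime obsFiltration N) :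
    {ω | ((0 : ℕ) : ℕ∞) < N ω} = ∅ ∨ {ω | ((0 : ℕ) : ℕ∞) < N ω} = Set.univ := by
  obtain ⟨C, -, hC⟩ := measurableSet_lt_stopping hN 0
  have : IsEmpty (Finset.range 0) := ⟨fun i => by simpa using i.2⟩
  rw [← hC]
  rcases C.eq_empty_or_nonempty with rfl | ⟨x, hx⟩
  · exact Or.inl rfl
  · refine Or.inr (Set.eq_univ_of_forall fun ω => ?_)
    rw [Set.mem_preimage]
    convert hx

/-- A uniform bound `d` on the conditional detection delays bounds the mean of a stopping time
under the law without change. -/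
theorem lintegral_stopping_le (hL : Measurable L) (hLp : ∀ x, 0 < L x) (hLi : Integrable L P)
    (hL1 : ∫ x, L x ∂P = 1) (hLl : Integrable (fun x => L x * Real.log (L x)) P)
    (hρ : ∫ x, √(L x) ∂P < 1)
    [IsProbabilityMeasure (P.withDensity fun x => ENNReal.ofReal (L x))]
    {N : (ℕ → ℝ) → ℕ∞} (hN : IsStoppingTime obsFiltration N) {d : ℝ} (hd : 0 ≤ d)
    (hD : ∀ k : ℕ, essSup (condLExp (obsFiltration k)
      (Measure.infinitePi fun i : ℕ =>
        if i + 1 < k + 1 then P else P.withDensity fun x => ENNReal.ofReal (L x))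
      fun ω => ((N ω + 1 - ((k + 1 : ℕ) : ℕ∞) : ℕ∞) : ℝ≥0∞))
      (Measure.infinitePi fun i : ℕ =>
        if i + 1 < k + 1 then P else P.withDensity fun x => ENNReal.ofReal (L x)) ≤
          ENNReal.ofReal d) :
    ∫⁻ ω, (N ω : ℝ≥0∞) ∂(Measure.infinitePi fun _ : ℕ => P) ≤
      ENNReal.ofReal (Real.exp ((∫ x, L x * Real.log (L x) ∂P) * d +
        (1 + 4 / (1 - ∫ x, √(L x) ∂P)))) := by
  set μ := Measure.infinitePi fun _ : ℕ => P
  have hI := integral_mul_log_pos hL hLp hLi hL1 hLl hρ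
  set A : ℕ → Set (ℕ → ℝ) := fun n => {ω | (n : ℕ∞) < N ω}
  have hAm : ∀ n, MeasurableSet[obsFiltration n] (A n) := measurableSet_lt_stopping hN
  have hAm' : ∀ n, MeasurableSet (A n) := fun n => obsFiltration.le n _ (hAm n)
  have hA : Antitone A := fun i j hij ω hω => by
    have h1 : (i : ℕ∞) ≤ j := by exact_mod_cast hij
    exact h1.trans_lt hω
  have hle : ∫⁻ ω, (N ω : ℝ≥0∞) ∂μ ≤ ∑' n, μ (A n) := by
    refine (lintegral_mono fun ω => coe_le_tsum_indicator N ω).trans (le_of_eq ?_)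
    rw [lintegral_tsum fun n => (measurable_one.indicator (hAm' n)).aemeasurable]
    exact tsum_congr fun n => lintegral_indicator_one (hAm' n)
  -- Triviality of the initial σ-algebra gives a dichotomy: `N` vanishes identically, or `N ≥ 1`
  -- everywhere, which yields `1 ≤ a` below.
  rcases setOf_pos_eq_empty_or_univ hN with h0 | h0
  · have h1 : ∀ n, A n = ∅ := fun n => Set.subset_empty_iff.1 ((hA n.zero_le).trans h0.le)
    refine hle.trans ?_
    simp [h1]
  refine hle.trans (le_of_tendsto' (ENNReal.tendsto_nat_tsum _) fun m => ?_)
  rcases Nat.eq_zero_or_pos m with rfl | hm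
  · simp
  have hsum : ∑ n ∈ Finset.range m, μ (A n) =
      ENNReal.ofReal (∑ n ∈ Finset.range m, μ.real (A n)) := by
    rw [ENNReal.ofReal_sum_of_nonneg fun n _ => measureReal_nonneg]
    exact Finset.sum_congr rfl fun n _ => (ofReal_measureReal (measure_ne_top _ _)).symm
  set a := ∑ n ∈ Finset.range m, μ.real (A n) with ha
  have ha1 : 1 ≤ a := by
    have h1 : μ.real (A 0) = 1 := by
      have : A 0 = Set.univ := h0
      rw [this]
      simp
    rw [← h1]
    exact Finset.single_le_sum (f := fun n => μ.real (A n)) (fun n _ => measureReal_nonneg)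
      (Finset.mem_range.2 hm)
  have key := mul_log_le_of_survival hL hLp hLi hL1 hLl hρ hA hAm m ha ha1
  have hS := sum_lintegral_srStat_le hL hLp hN hD m
  have hb : ∑ n ∈ Finset.range m, ∫ ω in A n, (1 + srStat L n ω) ∂μ ≤ d * a := by
    have h0 : ∀ n ω, 0 ≤ 1 + srStat L n ω := fun n ω => by linarith [srStat_nonneg hLp n ω]
    have e1 : ∀ n, ∫⁻ ω in A n, ENNReal.ofReal (1 + srStat L n ω) ∂μ =
        ENNReal.ofReal (∫ ω in A n, (1 + srStat L n ω) ∂μ) := fun n =>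
      (ofReal_integral_eq_lintegral_ofReal
        ((integrable_const 1).add (integrable_srStat hL hLi n)).integrableOn
        (Filter.Eventually.of_forall (h0 n))).symm
    have e2 : ∑ n ∈ Finset.range m, ENNReal.ofReal (∫ ω in A n, (1 + srStat L n ω) ∂μ) ≤
        ENNReal.ofReal (d * a) := by
      rw [ENNReal.ofReal_mul hd, ← hsum, ← Finset.sum_congr rfl fun n _ => e1 n]
      exact hS
    rw [← ENNReal.ofReal_sum_of_nonneg fun n _ => integral_nonneg (h0 n)] at e2
    exact (ENNReal.ofReal_le_ofReal_iff (mul_nonneg hd (by linarith))).1 e2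
  rw [hsum]
  refine ENNReal.ofReal_le_ofReal ?_
  rw [← Real.log_le_iff_le_exp (by linarith)]
  have a0 : 0 < a := by linarith
  refine le_of_mul_le_mul_left ?_ a0
  have := mul_le_mul_of_nonneg_left hb hI.le
  linarith

end LikelihoodRatio

/-! ### The likelihood ratio of the exponential family. -/

section ExponentialFamily

variable {F : Measure ℝ} {θ lam : ℝ}

theorem measurable_density (F : Measure ℝ) (ξ : ℝ) : Measurable (density F ξ) := by
  unfold density
  fun_prop

theorem density_pos (F : Measure ℝ) (ξ x : ℝ) : 0 < density F ξ x := Real.exp_pos _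

theorem density_div_density (F : Measure ℝ) (θ lam x : ℝ) :
    density F lam x / density F θ x =
      Real.exp ((lam - θ) * x - (cgf id F lam - cgf id F θ)) := by
  rw [density, density, ← Real.exp_sub]
  congr 1
  ring

theorem law_eq_withDensity_law (F : Measure ℝ) (θ lam : ℝ) :
    law F lam =
      (law F θ).withDensity fun x => ENNReal.ofReal (density F lam x / density F θ x) := by
  have h : Measurable fun x => density F lam x / density F θ x :=
    (measurable_density F lam).div (measurable_density F θ)
  rw [law, law, ← withDensity_mul _ (measurable_density F θ).ennreal_ofReal h.ennreal_ofReal]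
  congr 1
  funext x
  rw [Pi.mul_apply, ← ENNReal.ofReal_mul (density_pos F θ x).le,
    mul_div_cancel₀ _ (density_pos F θ x).ne']

theorem integrable_law_iff {ξ : ℝ} {f : ℝ → ℝ} :
    Integrable f (law F ξ) ↔ Integrable (fun x => density F ξ x * f x) F := by
  rw [law, integrable_withDensity_iff_integrable_smul' (measurable_density F ξ).ennreal_ofReal
    (Filter.Eventually.of_forall fun x => ENNReal.ofReal_lt_top)]
  simp_rw [ENNReal.toReal_ofReal (density_pos F ξ _).le, smul_eq_mul]

/-- The log ratio is affine in `x`, and an interior parameter has a finite first moment. -/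
theorem integrable_log_ratio (hlam : lam ∈ interior (integrableExpSet id F)) :
    Integrable (fun x => Real.log (density F lam x / density F θ x)) (law F lam) := by
  rw [integrable_law_iff]
  have h1 : Integrable (fun x : ℝ => x ^ 1 * Real.exp (lam * x)) F :=
    integrable_pow_mul_exp_of_mem_interior_integrableExpSet hlam 1
  have h0 : Integrable (fun x : ℝ => Real.exp (lam * x)) F :=
    interior_subset (s := integrableExpSet id F) hlam
  refine (((h1.const_mul (lam - θ)).sub (h0.const_mul (cgf id F lam - cgf id F θ))).const_mul
    (Real.exp (-cgf id F lam))).congr (Filter.Eventually.of_forall fun x => ?_)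
  simp only [Pi.sub_apply]
  rw [density_div_density, Real.log_exp, density, sub_eq_add_neg (lam * x), Real.exp_add]
  ring

/-- The ratio equals one at a single point only, and `F` is not concentrated there. -/
theorem not_ae_ratio_eq_one (hF : ∀ c : ℝ, F {c}ᶜ ≠ 0) (hne : lam ≠ θ) :
    ¬ ∀ᵐ x ∂(law F θ), density F lam x / density F θ x = 1 := by
  intro h
  refine hF ((cgf id F lam - cgf id F θ) / (lam - θ)) ?_
  have hac : F ≪ law F θ := withDensity_absolutelyContinuous'
    (measurable_density F θ).ennreal_ofReal.aemeasurable
    (Filter.Eventually.of_forall fun x => by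
      simpa using density_pos F θ x)
  refine hac (measure_mono_null (fun x hx => ?_) h)
  refine fun hx' => hx ?_
  rw [Set.mem_ofPred_eq, density_div_density, Real.exp_eq_one_iff] at hx'
  rw [Set.mem_singleton_iff, eq_div_iff (sub_ne_zero.2 hne)]
  linarith

end ExponentialFamily

end ChangePoint

end

open ChangePoint in
theorem proposition2p1 (F : Measure ℝ) [SigmaFinite F]
    (hF : ∀ c : ℝ, F {c}ᶜ ≠ 0)
    (θ lam : ℝ)
    (hθ : θ ∈ interior (integrableExpSet id F))
    (hlam : lam ∈ interior (integrableExpSet id F))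
    (hne : lam ≠ θ) :
    ∃ M : ℝ, 0 < M ∧
      ∀ N : (ℕ → ℝ) → ℕ∞, IsStoppingTime ChangePoint.obsFiltration N →
        ENNReal.log (ChangePoint.longARL F θ N) ≤
          (ChangePoint.klInfo F lam θ : EReal) * (ChangePoint.shortARL F θ lam N : EReal)
            + (M : EReal) := by
  have hF0 : F ≠ 0 := fun h => hF 0 (by simp [h])
  have hP : IsProbabilityMeasure (law F θ) :=
    isProbabilityMeasure_law F hF0 θ (interior_subset hθ)
  have hQ : IsProbabilityMeasure (law F lam) :=
    isProbabilityMeasure_law F hF0 lam (interior_subset hlam)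
  set L : ℝ → ℝ := fun x => density F lam x / density F θ x with hLdef
  have hlaw : law F lam = (law F θ).withDensity fun x => ENNReal.ofReal (L x) :=
    law_eq_withDensity_law F θ lam
  have hL : Measurable L := (measurable_density F lam).div (measurable_density F θ)
  have hLp : ∀ x, 0 < L x := fun x => div_pos (density_pos F lam x) (density_pos F θ x)
  have hQ' : IsProbabilityMeasure ((law F θ).withDensity fun x => ENNReal.ofReal (L x)) :=
    hlaw ▸ hQ
  have hlint : ∫⁻ x, ENNReal.ofReal (L x) ∂(law F θ) = 1 := by
    rw [← setLIntegral_univ, ← withDensity_apply _ MeasurableSet.univ, measure_univ]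
  have hLi : Integrable L (law F θ) := by
    refine ⟨hL.aestronglyMeasurable, ?_⟩
    rw [hasFiniteIntegral_iff_ofReal (Filter.Eventually.of_forall fun x => (hLp x).le), hlint]
    exact ENNReal.one_lt_top
  have hL1 : ∫ x, L x ∂(law F θ) = 1 := by
    rw [integral_eq_lintegral_of_nonneg_ae (Filter.Eventually.of_forall fun x => (hLp x).le)
      hL.aestronglyMeasurable, hlint, ENNReal.toReal_one]
  have hLl : Integrable (fun x => L x * Real.log (L x)) (law F θ) := by
    have h := integrable_log_ratio (θ := θ) hlam
    rw [hlaw, integrable_withDensity_iff_integrable_smul' hL.ennreal_ofReal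
      (Filter.Eventually.of_forall fun x => ENNReal.ofReal_lt_top)] at h
    simpa only [ENNReal.toReal_ofReal (hLp _).le, smul_eq_mul] using h
  have hkl : klInfo F lam θ = ∫ x, L x * Real.log (L x) ∂(law F θ) := by
    rw [klInfo, hlaw, integral_withDensity_eq_integral_toReal_smul hL.ennreal_ofReal
      (Filter.Eventually.of_forall fun x => ENNReal.ofReal_lt_top)]
    refine integral_congr_ae (Filter.Eventually.of_forall fun x => ?_)
    change (ENNReal.ofReal (L x)).toReal * Real.log (L x) = L x * Real.log (L x)
    rw [ENNReal.toReal_ofReal (hLp x).le]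
  have hρ : ∫ x, √(L x) ∂(law F θ) < 1 :=
    integral_sqrt_lt_one hL hLp hLi hL1 (not_ae_ratio_eq_one hF hne)
  have hI := integral_mul_log_pos hL hLp hLi hL1 hLl hρ
  refine ⟨1 + 4 / (1 - ∫ x, √(L x) ∂(law F θ)), ?_, fun N hN => ?_⟩
  · have : 0 < 1 - ∫ x, √(L x) ∂(law F θ) := by linarith
    positivity
  rw [hkl]
  -- For infinite delay, strict positivity of the information number is what makes the product `⊤`.
  by_cases hD : shortARL F θ lam N = ⊤
  · rw [hD, EReal.coe_ennreal_top, EReal.coe_mul_top_of_pos hI, EReal.top_add_coe]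
    exact le_top
  have hbound := lintegral_stopping_le hL hLp hLi hL1 hLl hρ hN
    (d := (shortARL F θ lam N).toReal) ENNReal.toReal_nonneg (fun k => by
      rw [ENNReal.ofReal_toReal hD, ← hlaw]
      exact le_iSup₂ (f := fun (ν : ℕ) (_ : 1 ≤ ν) => essSup
        (condLExp (obsFiltration (ν - 1)) (changeLaw F θ lam ν)
          fun ω => ((N ω + 1 - (ν : ℕ∞) : ℕ∞) : ℝ≥0∞)) (changeLaw F θ lam ν)) (k + 1) k.succ_pos)
  refine (ENNReal.log_monotone hbound).trans (le_of_eq ?_)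
  rw [ENNReal.log_ofReal_of_pos (Real.exp_pos _), Real.log_exp, EReal.coe_add, EReal.coe_mul,
    EReal.coe_ennreal_toReal hD]
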